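/- Let $\mathcal{A}$ be a finite set with the discrete topology, let $\sigma\colon\mathcal{A}^{\mathbb{Z}}\to\mathcal{A}^{\mathbb{Z}}$, $(\sigma x)(n)=x(n+1)$, be the left shift, and let $X\subseteq\mathcal{A}^{\mathbb{Z}}$ be a shift, that is, a closed set with $\sigma(X)=X$. Let $P_X(n)$ denote the number of words $(a_0,\dots,a_{n-1})\in\mathcal{A}^n$ for which there is $x\in X$ with $x(i)=a_i$ for $0\le i<n$, and let $\mathrm{Aut}(X)$ be the group of all homeomorphisms of $X$ onto itself that commute with $\sigma$. Suppose that there is a natural number $k$ such that $$\limsup_{n\to\infty}\frac{P_X(n)}{n}<k.$$ Then every finitely generated subgroup of $\mathrm{Aut}(X)$ is virtually $\mathbb{Z}^d$ for some integer $d$ with $0\le d<k$, that is, it contains a subgroup of finite index isomorphic to $\mathbb{Z}^d$. -/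

import Mathlib

open SymbolicDynamics.FullShift
open scoped ENNReal

namespace LinearShift

/-- The left shift `σ`, `(σ x)(n) = x (n + 1)`, as a homeomorphism of a two-sided subshift `X`
onto itself. -/
def sigma {A : Type*} [TopologicalSpace A] (X : Subshift A ℤ) : X.carrier ≃ₜ X.carrier where
  toFun x := ⟨shift 1 x.1, X.mapsTo 1 x.2⟩
  invFun x := ⟨shift (-1) x.1, X.mapsTo (-1) x.2⟩
  left_inv x := by
    apply Subtype.ext
    funext n
    simp
  right_inv x := by
    apply Subtype.ext
    funext n
    simp
  continuous_toFun := by fun_prop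
  continuous_invFun := by fun_prop

theorem sigma_apply {A : Type*} [TopologicalSpace A] (X : Subshift A ℤ) (x : X.carrier) (n : ℤ) :
    (sigma X x).1 n = x.1 (n + 1) := by
  simp [sigma, add_comm]

/-- The automorphism group of a subshift: the centralizer of `σ` in the group of all
homeomorphisms of `X` onto itself. -/
def Aut {A : Type*} [TopologicalSpace A] (X : Subshift A ℤ) : Subgroup (X.carrier ≃ₜ X.carrier) :=
  Subgroup.centralizer {sigma X}

/-- The words of length `n` in `X`: those `w = (a₀, …, aₙ₋₁)` whose one-sided cylinder set
`{x ∈ X | x i = aᵢ for 0 ≤ i < n}` is nonempty. -/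
def words {A : Type*} [TopologicalSpace A] (X : Subshift A ℤ) (n : ℕ) : Set (Fin n → A) :=
  {w | ∃ x ∈ X.carrier, ∀ i : Fin n, x ((i : ℕ) : ℤ) = w i}

/-- The factor complexity function `P_X(n)`, the number of words of length `n` in `X`. -/
noncomputable def complexity {A : Type*} [TopologicalSpace A] (X : Subshift A ℤ) (n : ℕ) : ℕ :=
  (words X n).ncard

/-- The group `G` is virtually `H`: it contains (a copy of) `H` as a subgroup of finite index. -/
def IsVirtually (G H : Type*) [Group G] [Group H] : Prop :=
  ∃ K : Subgroup G, K.FiniteIndex ∧ Nonempty (K ≃* H)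

end LinearShift

/-! Let `T` be the shift and `S` the set `asymptoticPoints X`. Linear complexity makes `S` small,
and an automorphism is almost determined by its action on `S`.

Counting: select one continuation of every left tail, periodic if possible (`TailSelection`); a
point is irregular if its symbol at 0 deviates from the selection. Any `m` left halves of irregular
points give eventually `P(n+1) ≥ P(n) + m`, so there are fewer than `k` of them
(`encard_irregularHalves_lt`). Consequently `S` consists of finitely many `T`-orbits.

Rigidity: an automorphism fixing `S` pointwise moves only periodic points of bounded period
(`exists_period_of_fixes`). Long right-special words look locally like points of `S`, so the
automorphism acts trivially near them. A point without such words far to the left is periodic; any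
other point has them arbitrarily far to the left, and triviality spreads from them to the right.

Algebra (`exists_isVirtually`): a finite-index subgroup preserves each orbit in `S` and acts there
by powers of `T`, so its commutators fix `S`. Fixing finitely many periodic points as well gives an
abelian subgroup `K` of finite index. The exponents of `T` at the points of `lastIrregular`, of
which there are fewer than `k`, define a homomorphism from `K` to a free abelian group. They
determine the action on all of `S` (`exists_translation_eq`), so the kernel fixes `S`; being
finitely generated, it is finite. -/

namespace LinearShift

/-! ### Virtually free abelian groups -/

section GroupTheory

theorem finiteIndex_of_map_eq {G α : Type*} [Group G] [Finite α] (K : Subgroup G) (f : G → α)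
    (h : ∀ a b, f a = f b → a⁻¹ * b ∈ K) : K.FiniteIndex := by
  have : Finite (G ⧸ K) := by
    refine Finite.of_injective (fun q : G ⧸ K => f q.out) fun p q hpq => ?_
    have := QuotientGroup.eq.2 (h _ _ hpq)
    simpa using this
  exact Subgroup.finiteIndex_of_finite_quotient

theorem IsVirtually.of_finiteIndex {G Z : Type*} [Group G] [Group Z] (K : Subgroup G)
    [hK : K.FiniteIndex] (h : IsVirtually K Z) : IsVirtually G Z := by
  obtain ⟨N, hN, ⟨e⟩⟩ := h
  refine ⟨N.map K.subtype, ⟨?_⟩,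
    ⟨(N.equivMapOfInjective K.subtype K.subtype_injective).symm.trans e⟩⟩
  rw [Subgroup.index_map_subtype]
  exact mul_ne_zero hN.index_ne_zero hK.index_ne_zero

/-- The image of `f` is a free ℤ-module, so `f` splits over it. The image of the section is free
abelian, and the kernel meets each of its cosets. -/
theorem exists_isVirtually_of_finite_ker {C ι : Type*} [CommGroup C] [Group.FG C] [Finite ι]
    (f : C →* Multiplicative (ι → ℤ)) (hf : Finite f.ker) :
    ∃ d : ℕ, d ≤ Nat.card ι ∧ IsVirtually C (Multiplicative (Fin d → ℤ)) := by
  classical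
  have := Fintype.ofFinite ι
  let φ : Additive C →ₗ[ℤ] (ι → ℤ) := (MonoidHom.toAdditiveLeft f).toIntLinearMap
  obtain ⟨s, hs⟩ := Module.projective_lifting_property φ.rangeRestrict
    (LinearMap.id : LinearMap.range φ →ₗ[ℤ] LinearMap.range φ) φ.surjective_rangeRestrict
  have hs' : ∀ y, φ.rangeRestrict (s y) = y := fun y => LinearMap.congr_fun hs y
  have hinj : Function.Injective s := Function.LeftInverse.injective hs'
  let b := Module.finBasis ℤ (LinearMap.range φ)
  let g : Multiplicative (LinearMap.range φ) →* C := AddMonoidHom.toMultiplicativeLeft s.toAddMonoidHom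
  have hg : Function.Injective g := hinj
  refine ⟨Module.finrank ℤ (LinearMap.range φ), ?_, g.range, ?_,
    ⟨(MonoidHom.ofInjective hg).symm.trans (AddEquiv.toMultiplicative b.equivFun.toAddEquiv)⟩⟩
  · refine (Submodule.finrank_le _).trans ?_
    simp
  · have : Finite (C ⧸ g.range) := by
      refine Finite.of_surjective (fun x : f.ker => (QuotientGroup.mk x.1 : C ⧸ g.range)) ?_
      intro q
      induction q using QuotientGroup.induction_on with
      | H c =>
        let y : LinearMap.range φ := φ.rangeRestrict (Additive.ofMul c)
        have hy : f (g (Multiplicative.ofAdd y)) = f c := by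
          have := congrArg Subtype.val (hs' y)
          exact this
        refine ⟨⟨c * (g (Multiplicative.ofAdd y))⁻¹, ?_⟩, ?_⟩
        · rw [MonoidHom.mem_ker, map_mul, map_inv, hy, mul_inv_cancel]
        · refine QuotientGroup.eq.2 ?_
          refine ⟨Multiplicative.ofAdd y, ?_⟩
          simp
    exact Subgroup.finiteIndex_of_finite_quotient

theorem fg_of_commGroup {C : Type*} [CommGroup C] [Group.FG C] (N : Subgroup C) : Group.FG N := by
  rw [GroupFG.iff_add_fg, ← Module.Finite.iff_addGroup_fg]
  have h : (AddSubgroup.toIntSubmodule N.toAddSubgroup).FG := IsNoetherian.noetherian _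
  exact Module.Finite.iff_fg.2 h

end GroupTheory

/-! ### Groups of permutations commuting with `T` -/

section Actions

variable {G X : Type*} [Group G] (ρ : G →* Equiv.Perm X) (T : Equiv.Perm X)

/-- The pointwise fixer of a set under a permutation representation. -/
def fixer (F : Set X) : Subgroup G where
  carrier := {g | ∀ x ∈ F, ρ g x = x}
  one_mem' x _ := by simp
  mul_mem' {g h} hg hh x hx := by
    rw [map_mul, Equiv.Perm.mul_apply, hh x hx, hg x hx]
  inv_mem' {g} hg x hx := by
    rw [map_inv, Equiv.Perm.inv_eq_iff_eq, hg x hx]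

theorem finiteIndex_fixer {F : Set X} (hF : F.Finite) (hinv : ∀ g, ∀ x ∈ F, ρ g x ∈ F) :
    (fixer ρ F).FiniteIndex := by
  have := hF.to_subtype
  refine finiteIndex_of_map_eq _ (fun g => fun x : F => (⟨ρ g x, hinv g x x.2⟩ : F)) ?_
  intro a b hab x hx
  have := congrArg Subtype.val (congrFun hab ⟨x, hx⟩)
  simp only at this
  rw [map_mul, map_inv, Equiv.Perm.mul_apply, Equiv.Perm.inv_eq_iff_eq]
  exact this.symm

variable {T}

theorem apply_zpow_comm {f : Equiv.Perm X} (h : Commute f T) (n : ℤ) (x : X) :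
    f ((T ^ n) x) = (T ^ n) (f x) :=
  Equiv.congr_fun (h.zpow_right n).eq x

theorem apply_pow_comm {f : Equiv.Perm X} (h : Commute f T) (n : ℕ) (x : X) :
    f ((T ^ n) x) = (T ^ n) (f x) :=
  Equiv.congr_fun (h.pow_right n).eq x

theorem sameCycle_apply {f : Equiv.Perm X} (h : Commute f T) {x y : X} (hxy : T.SameCycle x y) :
    T.SameCycle (f x) (f y) := by
  obtain ⟨n, rfl⟩ := hxy
  exact ⟨n, (apply_zpow_comm h n x).symm⟩

variable (hT : ∀ g, Commute (ρ g) T)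

/-- The elements of a group of permutations commuting with `T` which preserve each `T`-orbit
in `S`. -/
def orbitFixer (S : Set X) : Subgroup G where
  carrier := {g | ∀ x ∈ S, T.SameCycle x (ρ g x)}
  one_mem' x _ := by
    rw [map_one]
    exact Equiv.Perm.SameCycle.refl T x
  mul_mem' {g h} hg hh x hx := by
    rw [map_mul, Equiv.Perm.mul_apply]
    exact (hg x hx).trans (sameCycle_apply (hT g) (hh x hx))
  inv_mem' {g} hg x hx := by
    simpa using (sameCycle_apply (hT g⁻¹) (hg x hx)).symm

/-- The effect of `g` on the orbits in `S` is recorded by representatives in `B` of the orbits of `g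
b`, for `b` in `B`: finitely many possibilities. -/
theorem finiteIndex_orbitFixer {S B : Set X} (hS : ∀ g, ∀ x ∈ S, ρ g x ∈ S) (hB : B.Finite)
    (hBS : B ⊆ S) (hSB : ∀ x ∈ S, ∃ b ∈ B, T.SameCycle x b) :
    (orbitFixer ρ hT S).FiniteIndex := by
  have := hB.to_subtype
  choose! β hβB hβ using hSB
  refine finiteIndex_of_map_eq _
    (fun g => fun b : B => (⟨_, hβB _ (hS g b (hBS b.2))⟩ : B)) ?_
  intro g h hgh x hx
  have key := congrArg Subtype.val (congrFun hgh ⟨_, hβB x hx⟩)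
  simp only at key
  have h1 := hβ _ (hS g _ (hBS (hβB x hx)))
  rw [key] at h1
  have h2 := h1.trans (hβ _ (hS h _ (hBS (hβB x hx)))).symm
  have h3 := ((sameCycle_apply (hT g) (hβ x hx)).trans h2).trans
    (sameCycle_apply (hT h) (hβ x hx)).symm
  simpa using sameCycle_apply (hT g⁻¹) h3

theorem exists_common_period {S : Set X}
    (hc : ∀ g ∈ fixer ρ S, ∃ p : ℕ, 0 < p ∧ ∀ x, ρ g x = x ∨ (T ^ p) x = x)
    {s : Set G} (hs : s.Finite) (hsS : s ⊆ fixer ρ S) :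
    ∃ p : ℕ, 0 < p ∧ ∀ g ∈ s, ∀ x, ρ g x = x ∨ (T ^ p) x = x := by
  choose! p hp0 hp using hc
  refine ⟨∏ g ∈ hs.toFinset, p g, Finset.prod_pos fun g hg => hp0 g (hsS (by simpa using hg)), ?_⟩
  intro g hg x
  refine (hp g (hsS hg) x).imp_right fun h => ?_
  obtain ⟨m, hm⟩ := Finset.dvd_prod_of_mem p (hs.mem_toFinset.2 hg)
  rw [hm, pow_mul]
  exact Equiv.Perm.pow_apply_eq_self_of_apply_eq_self h m

-- A common period of finitely many generators bounds the periods of all points moved by the group.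
-- These points are finite in number, and the action is faithful.
include hT in
theorem finite_of_fixes {S : Set X} [Group.FG G] (hinj : Function.Injective ρ)
    (hper : ∀ p : ℕ, 0 < p → {x | (T ^ p) x = x}.Finite)
    (hc : ∀ g ∈ fixer ρ S, ∃ p : ℕ, 0 < p ∧ ∀ x, ρ g x = x ∨ (T ^ p) x = x)
    (hG : fixer ρ S = ⊤) : Finite G := by
  obtain ⟨s, hs⟩ := (Group.fg_def.1 ‹_› : (⊤ : Subgroup G).FG)
  obtain ⟨p, hp0, hp⟩ := exists_common_period ρ hc s.finite_toSet (fun g _ => hG ▸ Subgroup.mem_top g)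
  have hinv : ∀ g, ∀ x ∈ {x | (T ^ p) x = x}, ρ g x ∈ {x | (T ^ p) x = x} := by
    intro g x hx
    simp only [Set.mem_ofPred_eq] at hx ⊢
    rw [← apply_pow_comm (hT g), hx]
  have hfi := finiteIndex_fixer ρ (hper p hp0) hinv
  have htop : (⊤ : Subgroup G) ≤ fixer ρ {x | (T ^ p) x ≠ x} := by
    rw [← hs, Subgroup.closure_le]
    intro g hg x hx
    exact (hp g hg x).resolve_right hx
  have hbot : fixer ρ {x | (T ^ p) x = x} = ⊥ := by
    rw [eq_bot_iff]
    intro g hg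
    rw [Subgroup.mem_bot]
    apply hinj
    ext x
    rw [map_one, Equiv.Perm.one_apply]
    by_cases hx : (T ^ p) x = x
    · exact hg x hx
    · exact htop (Subgroup.mem_top g) x hx
  rw [hbot] at hfi
  have := hfi.index_ne_zero
  rw [Subgroup.index_bot] at this
  exact Nat.finite_of_card_ne_zero this

include hT in
theorem commute_on_orbits {S : Set X} {g h : G} (hg : g ∈ orbitFixer ρ hT S)
    (hh : h ∈ orbitFixer ρ hT S) {x : X} (hx : x ∈ S) : ρ g (ρ h x) = ρ h (ρ g x) := by
  obtain ⟨n, hn⟩ := hg x hx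
  obtain ⟨m, hm⟩ := hh x hx
  rw [← hn, ← hm, apply_zpow_comm (hT g), apply_zpow_comm (hT h), ← hn, ← hm,
    ← Equiv.Perm.mul_apply, ← Equiv.Perm.mul_apply, ← zpow_add, ← zpow_add, add_comm]

/-- A finitely generated group preserving the `T`-orbits in `S` is commutative away from the
points of some period. -/
theorem exists_commute_off_periodic {S : Set X} (K : Subgroup G) [Group.FG K]
    (hK : K ≤ orbitFixer ρ hT S)
    (hc : ∀ g ∈ fixer ρ S, ∃ p : ℕ, 0 < p ∧ ∀ x, ρ g x = x ∨ (T ^ p) x = x) :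
    ∃ p : ℕ, 0 < p ∧ ∀ g ∈ K, ∀ h ∈ K, ∀ x, (T ^ p) x ≠ x → ρ g (ρ h x) = ρ h (ρ g x) := by
  obtain ⟨s, hs⟩ := (Group.fg_iff_subgroup_fg K).1 ‹_›
  have hsK : ∀ g ∈ s, g ∈ K := fun g hg => hs ▸ Subgroup.subset_closure hg
  -- On an orbit in `S` the generators act as powers of `T`, so their commutators fix `S` pointwise.
  obtain ⟨p, hp0, hp⟩ := exists_common_period ρ hc
    (s := (fun q : G × G => (q.2 * q.1)⁻¹ * (q.1 * q.2)) '' (s ×ˢ s : Finset (G × G)))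
    ((Finset.finite_toSet _).image _) (by
      rintro _ ⟨⟨g, h⟩, hgh, rfl⟩ x hx
      simp only [Finset.coe_product, Set.mem_prod, Finset.mem_coe] at hgh
      have := commute_on_orbits ρ hT (hK (hsK g hgh.1)) (hK (hsK h hgh.2)) hx
      rw [map_mul, map_inv, Equiv.Perm.mul_apply, Equiv.Perm.inv_eq_iff_eq, map_mul, map_mul]
      simpa only [Equiv.Perm.mul_apply] using this)
  -- Invariance of the points not of period `p` lets commutation pass from generators to products
  -- and inverses.
  have hne : ∀ g x, (T ^ p) x ≠ x → (T ^ p) (ρ g x) ≠ ρ g x := by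
    intro g x hx h
    rw [← apply_pow_comm (hT g)] at h
    exact hx ((ρ g).injective h)
  refine ⟨p, hp0, fun g hg h hh => ?_⟩
  rw [← hs] at hg hh
  induction hg, hh using Subgroup.closure_induction₂ with
  | mem g h hg hh =>
    intro x hx
    have := (hp _ ⟨(g, h), by simpa using ⟨hg, hh⟩, rfl⟩ x).resolve_right hx
    rw [map_mul, map_inv, Equiv.Perm.mul_apply, Equiv.Perm.inv_eq_iff_eq, map_mul, map_mul] at this
    simpa only [Equiv.Perm.mul_apply] using this
  | one_left _ _ => simp
  | one_right _ _ => simp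
  | mul_left g₁ g₂ h _ _ _ h₁ h₂ =>
    intro x hx
    rw [map_mul, Equiv.Perm.mul_apply, Equiv.Perm.mul_apply, h₂ x hx, h₁ _ (hne g₂ x hx)]
  | mul_right g₁ g₂ h _ _ _ h₁ h₂ =>
    intro x hx
    rw [map_mul, Equiv.Perm.mul_apply, Equiv.Perm.mul_apply, ← h₂ x hx, h₁ _ (hne _ x hx)]
  | inv_left g h _ _ ih =>
    intro x hx
    apply (ρ g).injective
    rw [ih _ (hne _ x hx)]
    simp only [map_inv, Equiv.Perm.coe_inv, Equiv.apply_symm_apply]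
  | inv_right g h _ _ ih =>
    intro x hx
    apply (ρ h).injective
    rw [← ih _ (hne _ x hx)]
    simp only [map_inv, Equiv.Perm.coe_inv, Equiv.apply_symm_apply]

theorem zpow_apply_injective {y : X} (hy : ∀ p : ℕ, 0 < p → (T ^ p) y ≠ y) {m n : ℤ}
    (h : (T ^ m) y = (T ^ n) y) : m = n := by
  by_contra hne
  wlog hlt : m < n generalizing m n
  · exact this h.symm (Ne.symm hne) (by omega)
  refine hy (n - m).toNat (by omega) ?_
  rw [← zpow_natCast, Int.toNat_of_nonneg (by omega), sub_eq_neg_add, zpow_add,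
    Equiv.Perm.mul_apply, ← h, ← Equiv.Perm.mul_apply, ← zpow_add]
  simp

include hT in
/-- A finitely generated group of permutations commuting with `T` is virtually free abelian if
the elements which fix `S` pointwise only move periodic points of bounded period. -/
theorem exists_isVirtually {S B S₀ : Set X} [Group.FG G] (hinj : Function.Injective ρ)
    (hper : ∀ p : ℕ, 0 < p → {x | (T ^ p) x = x}.Finite)
    (hS : ∀ g, ∀ x ∈ S, ρ g x ∈ S) (hB : B.Finite)
    (hBS : B ⊆ S) (hSB : ∀ x ∈ S, ∃ b ∈ B, T.SameCycle x b)
    (hc : ∀ g ∈ fixer ρ S, ∃ p : ℕ, 0 < p ∧ ∀ x, ρ g x = x ∨ (T ^ p) x = x)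
    (hS₀ : S₀.Finite) (hS₀S : S₀ ⊆ S) (hS₀T : ∀ y ∈ S₀, ∀ p : ℕ, 0 < p → (T ^ p) y ≠ y)
    (hS₀' : ∀ x ∈ S, (∀ p : ℕ, 0 < p → (T ^ p) x ≠ x) → ∃ y ∈ S₀, ∀ g, ∀ m n : ℤ,
      ρ g x = (T ^ m) x → ρ g y = (T ^ n) y → m = n) :
    ∃ d : ℕ, d ≤ S₀.ncard ∧ IsVirtually G (Multiplicative (Fin d → ℤ)) := by
  have hfin₀ := finiteIndex_orbitFixer ρ hT hS hB hBS hSB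
  -- A finite-index subgroup of a finitely generated group is finitely generated, so the lemma
  -- applies to `orbitFixer`.
  obtain ⟨p₁, hp₁0, hp₁⟩ := exists_commute_off_periodic ρ hT (orbitFixer ρ hT S) le_rfl hc
  -- The periodic points of `S` lie on finitely many orbits, hence have a common period.
  have hp₂ : ∃ p : ℕ, 0 < p ∧ ∀ x ∈ S, (∃ q : ℕ, 0 < q ∧ (T ^ q) x = x) → (T ^ p) x = x := by
    have : ∀ b, ∃ q : ℕ, 0 < q ∧ ((∃ q : ℕ, 0 < q ∧ (T ^ q) b = b) → (T ^ q) b = b) := by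
      intro b
      by_cases h : ∃ q : ℕ, 0 < q ∧ (T ^ q) b = b
      · exact ⟨h.choose, h.choose_spec.1, fun _ => h.choose_spec.2⟩
      · exact ⟨1, one_pos, fun h' => absurd h' h⟩
    choose q hq0 hq using this
    refine ⟨∏ b ∈ hB.toFinset, q b, Finset.prod_pos fun b _ => hq0 b, ?_⟩
    rintro x hx ⟨r, hr0, hr⟩
    obtain ⟨b, hb, n, rfl⟩ := hSB x hx
    have e := fun i : ℕ => apply_pow_comm (T := T) (f := T ^ n) ((Commute.refl T).zpow_left n) i x
    have h1 := hq _ ⟨r, hr0, by rw [← e, hr]⟩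
    rw [← e] at h1
    obtain ⟨m, hm⟩ := Finset.dvd_prod_of_mem q (hB.mem_toFinset.2 hb)
    rw [hm, pow_mul]
    exact Equiv.Perm.pow_apply_eq_self_of_apply_eq_self ((T ^ n).injective h1) m
  obtain ⟨p₂, hp₂0, hp₂⟩ := hp₂
  have hinv : ∀ p : ℕ, ∀ g, ∀ x ∈ {x | (T ^ p) x = x}, ρ g x ∈ {x | (T ^ p) x = x} := by
    intro p g x hx
    simp only [Set.mem_ofPred_eq] at hx ⊢
    rw [← apply_pow_comm (hT g), hx]
  have hfin₁ := finiteIndex_fixer ρ (hper p₁ hp₁0) (hinv p₁)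
  have hfin₂ := finiteIndex_fixer ρ (hper p₂ hp₂0) (hinv p₂)
  -- Fixing the points of period `p₁` makes `K` commutative everywhere. Fixing those of period `p₂`
  -- handles the periodic points of `S`, which the translation exponents do not control.
  let K := orbitFixer ρ hT S ⊓ (fixer ρ {x | (T ^ p₁) x = x} ⊓ fixer ρ {x | (T ^ p₂) x = x})
  have hKfin : K.FiniteIndex := inferInstance
  have hcomm : ∀ g h : K, g * h = h * g := by
    rintro ⟨g, hg⟩ ⟨h, hh⟩
    apply Subtype.ext
    apply hinj
    ext x
    simp only [Subgroup.coe_mul, map_mul, Equiv.Perm.mul_apply]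
    by_cases hx : (T ^ p₁) x = x
    · rw [hg.2.1 x hx, hh.2.1 x hx, hg.2.1 x hx]
    · exact hp₁ g hg.1 h hh.1 x hx
  let _ : CommGroup K := { (inferInstance : Group K) with mul_comm := hcomm }
  have hτ : ∀ (g : K) (y : S₀), ∃ n : ℤ, ρ g y = (T ^ n) (y : X) := fun g y => by
    obtain ⟨n, hn⟩ := g.2.1 y (hS₀S y.2)
    exact ⟨n, hn.symm⟩
  choose τ hτ using hτ
  let f : K →* Multiplicative (S₀ → ℤ) := MonoidHom.mk' (fun g => Multiplicative.ofAdd (τ g)) (by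
    intro g h
    rw [← ofAdd_add]
    congr 1
    funext y
    apply zpow_apply_injective (hS₀T y y.2)
    rw [← hτ, Subgroup.coe_mul, map_mul, Equiv.Perm.mul_apply, hτ h, apply_zpow_comm (hT g), hτ g,
      ← Equiv.Perm.mul_apply, ← zpow_add, Pi.add_apply, add_comm])
  have : Finite S₀ := hS₀.to_subtype
  have hker : Finite f.ker := by
    have := fg_of_commGroup f.ker
    let ρ' : f.ker →* Equiv.Perm X := (ρ.comp K.subtype).comp f.ker.subtype
    refine finite_of_fixes (ρ := ρ') (T := T) (S := S) (fun g => hT _) ?_ hper (fun g hg => hc _ hg) ?_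
    · exact hinj.comp (K.subtype_injective.comp f.ker.subtype_injective)
    · rw [eq_top_iff]
      rintro ⟨g, hg⟩ - x hx
      change ρ g x = x
      by_cases hxp : ∃ q : ℕ, 0 < q ∧ (T ^ q) x = x
      · exact g.2.2.2 x (hp₂ x hx hxp)
      · push Not at hxp
        obtain ⟨y, hy, hxy⟩ := hS₀' x hx hxp
        obtain ⟨m, hm⟩ := g.2.1 x hx
        have h0 : τ g ⟨y, hy⟩ = 0 := congrFun (Multiplicative.ofAdd.injective hg) ⟨y, hy⟩
        have := hxy g m _ hm.symm (hτ g ⟨y, hy⟩)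
        rw [← hm, this, h0, zpow_zero, Equiv.Perm.one_apply]
  obtain ⟨d, hd, hv⟩ := exists_isVirtually_of_finite_ker f hker
  exact ⟨d, hd, hv.of_finiteIndex K⟩

end Actions

/-! ### Asymptotic points, compactness and rigidity of automorphisms -/

section Shift

variable {A : Type*} [TopologicalSpace A] (X : Subshift A ℤ)

/-- The left shift as a permutation of the points of a subshift. -/
def shiftPerm : Equiv.Perm X.carrier := (sigma X).toEquiv

variable {X}

theorem shiftPerm_apply (x : X.carrier) (i : ℤ) : (shiftPerm X x).1 i = x.1 (i + 1) :=
  sigma_apply X x i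

theorem shiftPerm_pow_apply (n : ℕ) (x : X.carrier) (i : ℤ) :
    ((shiftPerm X ^ n) x).1 i = x.1 (i + n) := by
  induction n generalizing i with
  | zero => simp
  | succ n ih =>
    rw [pow_succ', Equiv.Perm.mul_apply, shiftPerm_apply, ih]
    exact congrArg _ (by push_cast; ring)

theorem shiftPerm_zpow_apply (n : ℤ) (x : X.carrier) (i : ℤ) :
    ((shiftPerm X ^ n) x).1 i = x.1 (i + n) := by
  obtain ⟨m, rfl | rfl⟩ := n.eq_nat_or_neg
  · rw [zpow_natCast, shiftPerm_pow_apply]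
  · obtain ⟨y, rfl⟩ := (shiftPerm X ^ m).surjective x
    rw [zpow_neg, zpow_natCast, Equiv.Perm.coe_inv, Equiv.symm_apply_apply, shiftPerm_pow_apply]
    exact congrArg _ (by ring)

theorem shiftPerm_pow_eq_self_iff {n : ℕ} {x : X.carrier} :
    (shiftPerm X ^ n) x = x ↔ ∀ i, x.1 (i + n) = x.1 i := by
  rw [Subtype.ext_iff, funext_iff]
  simp only [shiftPerm_pow_apply]

variable (X) in
/-- The points having a different point of `X` in their left-asymptotic class. -/
def asymptoticPoints : Set X.carrier :=
  {x | ∃ y : X.carrier, y ≠ x ∧ ∃ t : ℤ, ∀ i < t, y.1 i = x.1 i}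

theorem mem_asymptoticPoints_of_ne {x y : X.carrier} {s t : ℤ} (h : ∀ i < t, y.1 i = x.1 i)
    (hs : y.1 s ≠ x.1 s) : x ∈ asymptoticPoints X :=
  ⟨y, fun e => hs (by rw [e]), t, h⟩

section Compactness

variable [DiscreteTopology A]

theorem isClosed_coord (Q : A → A → Prop) (i j : ℤ) :
    IsClosed {p : X.carrier × X.carrier | Q (p.1.1 i) (p.2.1 j)} := by
  have hc : Continuous fun p : X.carrier × X.carrier => (p.1.1 i, p.2.1 j) :=
    ((continuous_apply i).comp (continuous_subtype_val.comp continuous_fst)).prodMk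
      ((continuous_apply j).comp (continuous_subtype_val.comp continuous_snd))
  exact (isClosed_discrete {q : A × A | Q q.1 q.2}).preimage hc

theorem isClosed_forall {ι : Sort*} {Y : Type*} [TopologicalSpace Y] {P : ι → Y → Prop}
    (h : ∀ i, IsClosed {y | P i y}) : IsClosed {y | ∀ i, P i y} := by
  have : {y | ∀ i, P i y} = ⋂ i, {y | P i y} := by
    ext
    simp
  rw [this]
  exact isClosed_iInter h

variable [Finite A]

instance : CompactSpace X.carrier := isCompact_iff_compactSpace.1 X.isClosed.isCompact

theorem exists_forall_of_antitone {Y : Type*} [TopologicalSpace Y] [CompactSpace Y]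
    (P : ℕ → Y → Prop) (hP : ∀ n y, P (n + 1) y → P n y) (hc : ∀ n, IsClosed {y | P n y})
    (hne : ∀ n, ∃ y, P n y) : ∃ y, ∀ n, P n y := by
  obtain ⟨y, hy⟩ := IsCompact.nonempty_iInter_of_sequence_nonempty_isCompact_isClosed
    (fun n => {y | P n y}) (fun n y hy => hP n y hy) hne (hc 0).isCompact hc
  exact ⟨y, fun n => Set.mem_iInter.1 hy n⟩

/-- A continuous map commuting with the shift is a sliding block code. -/
theorem exists_range {φ : X.carrier → X.carrier} (hφ : Continuous φ)
    (hT : ∀ (n : ℤ) x, φ ((shiftPerm X ^ n) x) = (shiftPerm X ^ n) (φ x)) :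
    ∃ R : ℕ, ∀ (x y : X.carrier) (t : ℤ),
      (∀ i, t - R ≤ i → i ≤ t + R → x.1 i = y.1 i) → (φ x).1 t = (φ y).1 t := by
  suffices ∃ R : ℕ, ∀ x y : X.carrier,
      (∀ i : ℤ, -R ≤ i → i ≤ R → x.1 i = y.1 i) → (φ x).1 0 = (φ y).1 0 by
    obtain ⟨R, hR⟩ := this
    refine ⟨R, fun x y t h => ?_⟩
    have := hR ((shiftPerm X ^ t) x) ((shiftPerm X ^ t) y) fun i h1 h2 => by
      rw [shiftPerm_zpow_apply, shiftPerm_zpow_apply]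
      exact h _ (by omega) (by omega)
    rw [hT, hT, shiftPerm_zpow_apply, shiftPerm_zpow_apply] at this
    simpa using this
  -- By compactness, bad pairs for every radius yield one pair bad for all radii: equal points with
  -- different images.
  by_contra! hcon
  let P (n : ℕ) (p : X.carrier × X.carrier) : Prop :=
    (∀ i : ℤ, -n ≤ i → i ≤ n → p.1.1 i = p.2.1 i) ∧ (φ p.1).1 0 ≠ (φ p.2).1 0
  have hcl : ∀ n, IsClosed {p | P n p} := by
    intro n
    refine IsClosed.inter ?_ ?_
    · exact isClosed_forall fun i => isClosed_forall fun _ => isClosed_forall fun _ =>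
        isClosed_coord (· = ·) i i
    · exact (isClosed_coord (X := X) (· ≠ ·) 0 0).preimage (hφ.prodMap hφ)
  obtain ⟨⟨x, y⟩, h⟩ := exists_forall_of_antitone P
    (fun n p h => ⟨fun i h1 h2 => h.1 i (by push_cast; omega) (by push_cast; omega), h.2⟩)
    hcl (fun n => by
      obtain ⟨x, y, h⟩ := hcon n
      exact ⟨(x, y), h⟩)
  have : x = y := Subtype.ext <| funext fun i => (h i.natAbs).1 i (by omega) (by omega)
  exact (h 0).2 (by simp [this])

/-- Long right-special words are central blocks of points in `asymptoticPoints X`. -/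
theorem exists_asymptotic_of_special (R : ℕ) :
    ∃ n : ℕ, ∀ (x y : X.carrier) (t : ℤ), (∀ i, t - n ≤ i → i < t → x.1 i = y.1 i) →
      x.1 t ≠ y.1 t → ∃ z ∈ asymptoticPoints X, ∀ i, t - R ≤ i → i ≤ t + R → z.1 i = x.1 i := by
  suffices ∃ n : ℕ, ∀ x y : X.carrier, (∀ i : ℤ, -n ≤ i → i < 0 → x.1 i = y.1 i) →
      x.1 0 ≠ y.1 0 → ∃ z ∈ asymptoticPoints X, ∀ i : ℤ, -R ≤ i → i ≤ R → z.1 i = x.1 i by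
    obtain ⟨n, hn⟩ := this
    refine ⟨n, fun x y t h hne => ?_⟩
    obtain ⟨z, ⟨w, hw, s, hs⟩, hz⟩ := hn ((shiftPerm X ^ t) x) ((shiftPerm X ^ t) y)
      (fun i h1 h2 => by
        rw [shiftPerm_zpow_apply, shiftPerm_zpow_apply]
        exact h _ (by omega) (by omega))
      (by simpa [shiftPerm_zpow_apply] using hne)
    refine ⟨(shiftPerm X ^ (-t)) z, ⟨(shiftPerm X ^ (-t)) w, fun e => hw (Equiv.injective _ e),
      s + t, fun i hi => ?_⟩, fun i h1 h2 => ?_⟩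
    · rw [shiftPerm_zpow_apply, shiftPerm_zpow_apply]
      exact hs _ (by omega)
    · rw [shiftPerm_zpow_apply, hz _ (by omega) (by omega), shiftPerm_zpow_apply]
      simp
  -- By compactness, counterexamples for every `n` yield a pair `x`, `y` equal on all negative
  -- coordinates and different at 0. Then `x` is itself asymptotic and matches its own central
  -- block.
  by_contra! hcon
  let P (n : ℕ) (p : X.carrier × X.carrier) : Prop :=
    (∀ i : ℤ, -n ≤ i → i < 0 → p.1.1 i = p.2.1 i) ∧ p.1.1 0 ≠ p.2.1 0 ∧
      ∀ z ∈ asymptoticPoints X, ∃ i : ℤ, -R ≤ i ∧ i ≤ R ∧ z.1 i ≠ p.1.1 i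
  have hcl : ∀ n, IsClosed {p | P n p} := by
    intro n
    refine IsClosed.inter ?_ (IsClosed.inter (isClosed_coord (· ≠ ·) 0 0) ?_)
    · exact isClosed_forall fun i => isClosed_forall fun _ => isClosed_forall fun _ =>
        isClosed_coord (· = ·) i i
    · refine isClosed_forall fun z => isClosed_forall fun _ => ?_
      have : {p : X.carrier × X.carrier | ∃ i : ℤ, -R ≤ i ∧ i ≤ R ∧ z.1 i ≠ p.1.1 i} =
          ⋃ i ∈ Set.Icc (-R : ℤ) R, {p | z.1 i ≠ p.1.1 i} := by
        ext
        simp [and_assoc]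
      rw [this]
      exact (Set.finite_Icc _ _).isClosed_biUnion fun i _ =>
        isClosed_coord (fun a _ => z.1 i ≠ a) i i
  obtain ⟨⟨x, y⟩, h⟩ := exists_forall_of_antitone P
    (fun n p h => ⟨fun i h1 h2 => h.1 i (by push_cast; omega) h2, h.2⟩)
    hcl (fun n => by
      obtain ⟨x, y, h⟩ := hcon n
      exact ⟨(x, y), h⟩)
  obtain ⟨i, -, -, hi⟩ := (h 0).2.2 x
    (mem_asymptoticPoints_of_ne (y := y) (t := 0) (s := 0)
      (fun i hi => ((h i.natAbs).1 i (by omega) (by omega)).symm) (h 0).2.1.symm)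
  exact hi rfl

end Compactness

section Periodic

variable [Finite A]

theorem finite_periodic {p : ℕ} (hp : 0 < p) :
    {x : X.carrier | (shiftPerm X ^ p) x = x}.Finite := by
  refine Set.Finite.of_finite_image (f := fun x : X.carrier => fun i : Fin p => x.1 (i : ℕ))
    (Set.toFinite _) ?_
  intro x hx y hy hxy
  rw [Set.mem_ofPred_eq, shiftPerm_pow_eq_self_iff] at hx hy
  have key : ∀ z : ℤ → A, (∀ i, z (i + p) = z i) → ∀ i, z i = z (i % p) := fun z hz i => by
    have : Function.Periodic z p := hz
    conv_lhs => rw [← Int.emod_add_mul_ediv i p]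
    rw [mul_comm]
    exact this.int_mul _ _
  refine Subtype.ext (funext fun i => ?_)
  rw [key _ hx, key _ hy]
  have h0 := Int.emod_nonneg i (b := p) (by omega)
  have h1 := Int.emod_lt_of_pos i (b := p) (by omega)
  have := congrFun hxy ⟨(i % p).toNat, by omega⟩
  simpa [Int.toNat_of_nonneg h0] using this

/-- Two of `N + 1` consecutive windows of length `n` coincide, at a distance `q ≤ N`. Each symbol up
to `t₀` is determined by the `n` preceding ones, so the period `q` persists up to `t₀`. The
factorial of `N` is a multiple of every such `q`. -/
theorem exists_period_of_not_special_le (n : ℕ) : ∃ Q : ℕ, 0 < Q ∧ ∀ (x : X.carrier) (t₀ : ℤ),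
    (∀ t ≤ t₀, ∀ y : X.carrier, (∀ i, t - n ≤ i → i < t → x.1 i = y.1 i) → x.1 t = y.1 t) →
    ∀ i ≤ t₀ - Q, x.1 i = x.1 (i + Q) := by
  classical
  have := Fintype.ofFinite A
  set N := Fintype.card (Fin n → A)
  refine ⟨N.factorial, N.factorial_pos, fun x t₀ ht₀ => ?_⟩
  set Q := N.factorial
  have hlow : ∀ t t' : ℤ, t ≤ t₀ - N → t ≤ t' → t' ≤ t₀ - Q → x.1 t' = x.1 (t' + Q) := by
    intro t t' ht htt' ht'
    obtain ⟨a, b, hab, heq⟩ := Fintype.exists_ne_map_eq_of_card_lt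
      (fun (a : Fin (N + 1)) (i : Fin n) => x.1 (t - N - n + a + i)) (by simp [N])
    wlog hlt : a < b generalizing a b
    · exact this b a hab.symm heq.symm (lt_of_le_of_ne (not_lt.1 hlt) hab.symm)
    obtain ⟨q, hq⟩ : ∃ q : ℕ, (b : ℕ) = a + q := Nat.exists_eq_add_of_le (le_of_lt hlt)
    have hq0 : 0 < q := by
      have : (a : ℕ) < b := hlt
      omega
    have hqN : q ≤ N := by have := b.2; omega
    have hper : ∀ k : ℕ, ∀ i : ℤ, t - N - n + a ≤ i → i < t - N + a + k → i + q ≤ t₀ →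
        x.1 i = x.1 (i + q) := by
      intro k
      induction k with
      | zero =>
        intro i h1 h2 _
        have := congrFun heq ⟨(i - (t - N - n + a)).toNat, by omega⟩
        simp only [hq] at this
        rw [Int.toNat_of_nonneg (by omega)] at this
        convert this using 2
        · ring
        · push_cast
          ring
      | succ k ih =>
        intro i h1 h2 h3
        by_cases hi : i < t - N + a + k
        · exact ih i h1 hi h3
        · have := ht₀ i (by omega) ((shiftPerm X ^ q) x) fun j hj1 hj2 => by
            rw [shiftPerm_pow_apply]
            exact ih j (by push_cast at *; omega) (by push_cast at *; omega) (by omega)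
          rwa [shiftPerm_pow_apply] at this
    obtain ⟨m, hm⟩ : q ∣ Q := Nat.dvd_factorial hq0 hqN
    have hmul : ∀ j : ℕ, ∀ i : ℤ, t - N ≤ i → i + q * j ≤ t₀ → t - N - n + a ≤ i →
        x.1 i = x.1 (i + q * j) := by
      intro j
      induction j with
      | zero => simp
      | succ j ih =>
        intro i h1 h2 h3
        push_cast at h2 ⊢
        have hj : (0 : ℤ) ≤ q * j := by positivity
        rw [ih i h1 (by linarith) h3, hper (i + q * j - (t - N + a) + 1).toNat (i + q * j)
          (by linarith) (by omega) (by linarith)]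
        exact congrArg _ (by ring)
    have hQ : (Q : ℤ) = q * m := by exact_mod_cast hm
    rw [hQ]
    have := a.2
    exact hmul m t' (by omega) (by rw [← hQ]; omega) (by omega)
  exact fun i hi => hlow (min i (t₀ - N)) i (by omega) (by omega) hi

/-- Points without right-special words of length `n` far on the left are periodic. -/
theorem exists_period_of_not_special (n : ℕ) : ∃ Q : ℕ, 0 < Q ∧ ∀ (x : X.carrier) (t₀ : ℤ),
    (∀ t ≤ t₀, ∀ y : X.carrier, (∀ i, t - n ≤ i → i < t → x.1 i = y.1 i) → x.1 t = y.1 t) →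
    (shiftPerm X ^ Q) x = x := by
  obtain ⟨Q, hQ0, hQ⟩ := exists_period_of_not_special_le (X := X) n
  refine ⟨Q, hQ0, fun x t₀ ht₀ => ?_⟩
  -- Determinism extends past `t₀`: the window before `t` repeats the one before `t - Q`, so every
  -- continuation must carry the symbol at `t - Q`.
  have hns : ∀ k : ℕ, ∀ t ≤ t₀ + k, ∀ y : X.carrier,
      (∀ i, t - n ≤ i → i < t → x.1 i = y.1 i) → x.1 t = y.1 t := by
    intro k
    induction k with
    | zero => simpa using ht₀
    | succ k ih =>
      intro t ht y hy
      by_cases ht' : t ≤ t₀ + k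
      · exact ih t ht' y hy
      · have hx := hQ x _ ih
        have h1 := ih (t - Q) (by push_cast at ht; omega) ((shiftPerm X ^ Q) y) fun i h1 h2 => by
          rw [shiftPerm_pow_apply, hx i (by push_cast at ht; omega)]
          exact hy _ (by omega) (by omega)
        have h2 := ih (t - Q) (by push_cast at ht; omega) ((shiftPerm X ^ Q) x) fun i h1 h2 => by
          rw [shiftPerm_pow_apply, hx i (by push_cast at ht; omega)]
        rw [shiftPerm_pow_apply, sub_add_cancel] at h1 h2
        rw [← h1, h2]
  rw [shiftPerm_pow_eq_self_iff]
  exact fun i => (hQ x _ (hns (i + Q - t₀).toNat) i (by omega)).symm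

end Periodic

section Automorphisms

variable [DiscreteTopology A] [Finite A]

theorem exists_forall_lt_apply_eq {φ : X.carrier → X.carrier} (hφ : Continuous φ)
    (hT : ∀ (n : ℤ) x, φ ((shiftPerm X ^ n) x) = (shiftPerm X ^ n) (φ x))
    {x y : X.carrier} {t : ℤ} (h : ∀ i < t, y.1 i = x.1 i) :
    ∃ s : ℤ, ∀ i < s, (φ y).1 i = (φ x).1 i := by
  obtain ⟨R, hR⟩ := exists_range hφ hT
  exact ⟨t - R, fun i hi => hR _ _ _ fun j _ _ => h j (by omega)⟩

/-- An endomorphism fixing all points of `asymptoticPoints X` only moves periodic points of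
bounded period. -/
theorem exists_period_of_fixes {φ : X.carrier → X.carrier} (hφ : Continuous φ)
    (hT : ∀ (n : ℤ) x, φ ((shiftPerm X ^ n) x) = (shiftPerm X ^ n) (φ x))
    (hfix : ∀ x ∈ asymptoticPoints X, φ x = x) :
    ∃ p : ℕ, 0 < p ∧ ∀ x, φ x = x ∨ (shiftPerm X ^ p) x = x := by
  obtain ⟨R, hR⟩ := exists_range hφ hT
  obtain ⟨n, hn⟩ := exists_asymptotic_of_special (X := X) R
  -- Radius `R + n` makes `φ x` agree with `x` on the whole of `[t - n, t]`, enough to start the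
  -- induction below.
  obtain ⟨m, hm⟩ := exists_asymptotic_of_special (X := X) (R + n)
  obtain ⟨Q, hQ0, hQ⟩ := exists_period_of_not_special (X := X) m
  refine ⟨Q, hQ0, fun x => ?_⟩
  by_cases hx : ∃ t₀ : ℤ, ∀ t ≤ t₀, ∀ y : X.carrier,
      (∀ i, t - m ≤ i → i < t → x.1 i = y.1 i) → x.1 t = y.1 t
  · obtain ⟨t₀, ht₀⟩ := hx
    exact Or.inr (hQ x t₀ ht₀)
  · left
    push Not at hx
    have hcopy : ∀ z ∈ asymptoticPoints X, ∀ i : ℤ,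
        (∀ j, i - R ≤ j → j ≤ i + R → z.1 j = x.1 j) → (φ x).1 i = x.1 i := by
      intro z hz i h
      rw [← hR z x i h, hfix z hz]
      exact h i (by omega) (by omega)
    refine Subtype.ext (funext fun i => ?_)
    obtain ⟨t, hti, y, hy, hne⟩ := hx i
    obtain ⟨z, hz, hzx⟩ := hm x y t hy hne
    have key : ∀ k : ℕ, ∀ i : ℤ, t - n ≤ i → i ≤ t + k → x.1 i = (φ x).1 i := by
      intro k
      induction k with
      | zero =>
        intro i h1 h2
        exact (hcopy z hz i fun j _ _ => hzx j (by push_cast at *; omega)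
          (by push_cast at *; omega)).symm
      | succ k ih =>
        intro i h1 h2
        push_cast at h2
        by_cases hi : i ≤ t + k
        · exact ih i h1 hi
        · by_contra hne
          -- At a first disagreement, `x` and `φ x` show a right-special word; hence `x` looks near
          -- `i` like a fixed point of `φ`, and there is no disagreement.
          obtain ⟨w, hw, hwx⟩ := hn x (φ x) i (fun j _ _ => ih j (by omega) (by omega)) hne
          exact hne (hcopy w hw i hwx).symm
    exact (key (i - t).toNat i (by omega) (by omega)).symm

end Automorphisms

end Shift

/-! ### Selected continuations and counting of irregular points -/

section Selection

variable {A : Type*} [TopologicalSpace A] {X : Subshift A ℤ}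

theorem ext_of_periodic {x y : X.carrier} {t : ℤ} {p q : ℕ} (hp : 0 < p) (hq : 0 < q)
    (hx : (shiftPerm X ^ p) x = x) (hy : (shiftPerm X ^ q) y = y)
    (h : ∀ i < t, x.1 i = y.1 i) : x = y := by
  have hx' : Function.Periodic x.1 p := shiftPerm_pow_eq_self_iff.1 hx
  have hy' : Function.Periodic y.1 q := shiftPerm_pow_eq_self_iff.1 hy
  refine Subtype.ext (funext fun i => ?_)
  -- Both sides move `i` to the left by `p * q * (|i - t| + 1)`, a common multiple of the periods
  -- large enough to get below `t`.
  rw [← hx'.int_mul (-(q * (i - t).natAbs + q)) i, ← hy'.int_mul (-(p * (i - t).natAbs + p)) i,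
    Int.cast_id, Int.cast_id,
    show (-(q * (i - t).natAbs + q) * p : ℤ) = -(p * (i - t).natAbs + p) * q by ring]
  apply h
  have h3 : (1 : ℤ) ≤ p * q := by exact_mod_cast Nat.mul_pos hp hq
  nlinarith [le_abs_self (i - t), Int.natCast_natAbs (i - t), abs_nonneg (i - t)]

theorem exists_first_ne {x y : X.carrier} (hne : y ≠ x) {t : ℤ} (h : ∀ i < t, y.1 i = x.1 i) :
    ∃ s : ℤ, (∀ i < s, y.1 i = x.1 i) ∧ y.1 s ≠ x.1 s := by
  obtain ⟨s, hs⟩ : ∃ s, y.1 s ≠ x.1 s := by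
    by_contra! hcon
    exact hne (Subtype.ext (funext hcon))
  obtain ⟨s, hs, hmin⟩ := Int.exists_least_of_bdd (P := fun s => y.1 s ≠ x.1 s)
    ⟨t, fun z hz => not_lt.1 fun hzt => hz (h z hzt)⟩ ⟨s, hs⟩
  exact ⟨s, fun i hi => not_not.1 fun hne => absurd (hmin i hne) (not_le.2 hi), hs⟩

theorem shiftPerm_zpow_congr {x y : X.carrier} {t : ℤ} (h : ∀ i < t, x.1 i = y.1 i) :
    ∀ i < 0, ((shiftPerm X ^ t) x).1 i = ((shiftPerm X ^ t) y).1 i := by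
  intro i hi
  rw [shiftPerm_zpow_apply, shiftPerm_zpow_apply]
  exact h _ (by omega)

variable (X) in
/-- A choice of a point of `X` in each class of points sharing the same left tail, which is the
periodic one if there is any. -/
structure TailSelection where
  /-- The representative of a point. -/
  rep : X.carrier → X.carrier
  rep_apply : ∀ x, ∀ i < 0, (rep x).1 i = x.1 i
  rep_congr : ∀ x y, (∀ i < 0, x.1 i = y.1 i) → rep x = rep y
  rep_of_periodic : ∀ x p, 0 < p → (shiftPerm X ^ p) x = x → rep x = x

theorem nonempty_tailSelection : Nonempty (TailSelection X) := by
  classical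
  let R (P : X.carrier → Prop) (hP : ∃ z, P z) : X.carrier :=
    if h : ∃ z, (∃ p, 0 < p ∧ (shiftPerm X ^ p) z = z) ∧ P z then h.choose else hP.choose
  have hR : ∀ (P : X.carrier → Prop) (hP : ∃ z, P z), P (R P hP) := by
    intro P hP
    by_cases h : ∃ z, (∃ p, 0 < p ∧ (shiftPerm X ^ p) z = z) ∧ P z
    · simp only [R, dif_pos h]
      exact h.choose_spec.2
    · simp only [R, dif_neg h]
      exact hP.choose_spec
  have hR' : ∀ (P Q : X.carrier → Prop) (hP : ∃ z, P z) (hQ : ∃ z, Q z), P = Q → R P hP = R Q hQ := by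
    rintro P _ hP hQ rfl
    rfl
  refine ⟨fun x => R (fun z => ∀ i < 0, z.1 i = x.1 i) ⟨x, fun _ _ => rfl⟩,
    fun x => hR (fun z => ∀ i < 0, z.1 i = x.1 i) _, fun x y h => hR' _ _ _ _ ?_, fun x p hp hx => ?_⟩
  · funext z
    exact propext (forall₂_congr fun i hi => by rw [h i hi])
  · have h : ∃ z : X.carrier, (∃ p, 0 < p ∧ (shiftPerm X ^ p) z = z) ∧ ∀ i < 0, z.1 i = x.1 i :=
      ⟨x, ⟨p, hp, hx⟩, fun _ _ => rfl⟩
    simp only [R, dif_pos h]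
    -- A left tail belongs to at most one periodic point, so the chosen one is `x`.
    obtain ⟨⟨q, hq, hz⟩, hzx⟩ := h.choose_spec
    exact ext_of_periodic hq hp hz hx hzx

/-- A point is irregular if its symbol at `0` is not the selected continuation of its left tail. -/
def TailSelection.Irregular (s : TailSelection X) (x : X.carrier) : Prop :=
  (s.rep x).1 0 ≠ x.1 0

/-- The restriction of a point to the nonpositive coordinates. -/
def leftHalf (x : X.carrier) (i : {i : ℤ // i ≤ 0}) : A := x.1 i

theorem leftHalf_eq_iff {x y : X.carrier} :
    leftHalf x = leftHalf y ↔ ∀ i ≤ 0, x.1 i = y.1 i := by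
  simp [leftHalf, funext_iff]

namespace TailSelection

variable (s : TailSelection X)

theorem not_irregular_of_periodic {x : X.carrier} {p : ℕ} (hp : 0 < p)
    (hx : (shiftPerm X ^ p) x = x) (n : ℤ) : ¬ s.Irregular ((shiftPerm X ^ n) x) := by
  have : s.rep ((shiftPerm X ^ n) x) = (shiftPerm X ^ n) x :=
    s.rep_of_periodic _ p hp (by
      rw [← apply_pow_comm (f := shiftPerm X ^ n) ((Commute.refl _).zpow_left n), hx])
  simp [Irregular, this]

theorem mem_asymptoticPoints_of_irregular {x : X.carrier} (hx : s.Irregular x) :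
    x ∈ asymptoticPoints X :=
  mem_asymptoticPoints_of_ne (s.rep_apply x) hx

/-- Two different continuations of the same tail cannot both be the selected one. -/
theorem irregular_or_of_ne {x y : X.carrier} {t : ℤ} (h : ∀ i < t, y.1 i = x.1 i)
    (hne : y.1 t ≠ x.1 t) :
    s.Irregular ((shiftPerm X ^ t) x) ∨ s.Irregular ((shiftPerm X ^ t) y) := by
  by_contra! hcon
  simp only [Irregular, not_not, s.rep_congr _ _ (shiftPerm_zpow_congr h)] at hcon
  have := hcon.1.symm.trans hcon.2
  rw [shiftPerm_zpow_apply, shiftPerm_zpow_apply, zero_add] at this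
  exact hne this.symm

theorem ext_of_regular {x y : X.carrier} (h : ∀ i < 0, x.1 i = y.1 i)
    (hx : ∀ n : ℕ, ¬ s.Irregular ((shiftPerm X ^ n) x))
    (hy : ∀ n : ℕ, ¬ s.Irregular ((shiftPerm X ^ n) y)) : x = y := by
  by_contra hne
  obtain ⟨t, ht, htne⟩ := exists_first_ne hne h
  have ht0 : 0 ≤ t := not_lt.1 fun h0 => htne (h t h0)
  lift t to ℕ using ht0
  have := s.irregular_or_of_ne ht htne
  rw [zpow_natCast] at this
  exact this.elim (hy t) (hx t)

section Counting

variable [Finite A]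

/-- Every word of length `n` has an extension that follows the selection if the word ends the tail
of a point of `E`. The points of `E`, read on `[-n, 0]`, give further words, since their last
symbols deviate from it. -/
theorem complexity_add_card_le (E : Finset X.carrier) (hE : ∀ x ∈ E, s.Irregular x)
    (hinj : ∀ x ∈ E, ∀ y ∈ E, leftHalf x = leftHalf y → x = y) :
    ∃ N, ∀ n ≥ N, complexity X n + E.card ≤ complexity X (n + 1) := by
  have hN : ∀ q : X.carrier × X.carrier, ∃ N : ℕ,
      (∀ i : ℤ, -N ≤ i → i < 0 → q.1.1 i = q.2.1 i) → ∀ i < 0, q.1.1 i = q.2.1 i := by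
    intro q
    by_cases h : ∀ i < 0, q.1.1 i = q.2.1 i
    · exact ⟨0, fun _ => h⟩
    · push Not at h
      obtain ⟨i, hi, hne⟩ := h
      exact ⟨i.natAbs, fun h' => absurd (h' i (by omega) hi) hne⟩
  choose N hN using hN
  -- From this length on, a finite block before 0 distinguishes all distinct left tails occurring in
  -- `E`.
  refine ⟨(E ×ˢ E).sup N, fun n hn => ?_⟩
  have htail : ∀ x ∈ E, ∀ y ∈ E, (∀ i : Fin n, x.1 (i - n) = y.1 (i - n)) →
      ∀ i < 0, x.1 i = y.1 i := by
    intro x hx y hy h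
    have hle := (Finset.le_sup (f := N) (Finset.mk_mem_product hx hy)).trans hn
    refine hN (x, y) fun i h1 h2 => ?_
    have := h ⟨(i + n).toNat, by omega⟩
    simp only at this
    rw [Int.toNat_of_nonneg (by omega)] at this
    simpa using this
  have hext : ∀ w : words X n, ∃ x : X.carrier, (∀ i : Fin n, x.1 (i : ℕ) = w.1 i) ∧
      ∀ e ∈ E, (∀ i : Fin n, e.1 (i - n) = w.1 i) → x.1 n = (s.rep e).1 0 := by
    rintro ⟨w, x, hx, hxw⟩
    by_cases h : ∃ e ∈ E, ∀ i : Fin n, e.1 (i - n) = w i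
    · obtain ⟨e, he, hew⟩ := h
      refine ⟨(shiftPerm X ^ (-n : ℤ)) (s.rep e), fun i => ?_, fun e' he' hew' => ?_⟩
      · rw [shiftPerm_zpow_apply]
        exact (s.rep_apply e _ (by omega)).trans (hew i)
      · rw [shiftPerm_zpow_apply, add_neg_cancel,
          s.rep_congr e e' (htail e he e' he' fun i => (hew i).trans (hew' i).symm)]
    · push Not at h
      refine ⟨⟨x, hx⟩, hxw, fun e he hew => ?_⟩
      obtain ⟨i, hi⟩ := h e he
      exact absurd (hew i) hi
  choose z hz hzE using hext
  let f : words X n ⊕ E → words X (n + 1) := Sum.elim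
    (fun w => ⟨fun i => (z w).1 (i : ℕ), (z w).1, (z w).2, fun i => rfl⟩)
    (fun e => ⟨fun i => e.1.1 (i - n), ((shiftPerm X ^ (-n : ℤ)) e.1).1,
      ((shiftPerm X ^ (-n : ℤ)) e.1).2, fun i => by rw [shiftPerm_zpow_apply]; rfl⟩)
  have hlast : ∀ (w : words X n) (e : E), f (Sum.inl w) ≠ f (Sum.inr e) := by
    intro w e h
    have h' : ∀ i : Fin (n + 1), (z w).1 (i : ℕ) = e.1.1 (i - n) :=
      fun i => congrFun (congrArg Subtype.val h) i
    refine hE e e.2 ?_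
    rw [← hzE w e e.2 fun i => by rw [← hz w i]; exact (h' i.castSucc).symm]
    simpa using h' (Fin.last n)
  have hf : Function.Injective f := by
    rintro (w | e) (w' | e') h
    · congr 1
      refine Subtype.ext (funext fun i => ?_)
      rw [← hz, ← hz]
      exact congrFun (congrArg Subtype.val h) i.castSucc
    · exact absurd h (hlast w e')
    · exact absurd h.symm (hlast w' e)
    · have h' : ∀ i : Fin (n + 1), e.1.1 (i - n) = e'.1.1 (i - n) :=
        fun i => congrFun (congrArg Subtype.val h) i
      congr 1
      refine Subtype.ext (hinj e e.2 e' e'.2 (leftHalf_eq_iff.2 fun i hi => ?_))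
      rcases hi.lt_or_eq with hi | rfl
      · exact htail e e.2 e' e'.2 (fun i => h' i.castSucc) i hi
      · simpa using h' (Fin.last n)
  have := Nat.card_le_card_of_injective f hf
  rw [Nat.card_sum, Nat.card_coe_set_eq, Nat.card_coe_set_eq, Nat.card_eq_fintype_card,
    Fintype.card_coe] at this
  exact this

end Counting

end TailSelection

theorem lt_of_limsup_div_lt {P : ℕ → ℕ} {k m N : ℕ}
    (hP : Filter.limsup (fun n : ℕ => (P n : ℝ≥0∞) / (n : ℝ≥0∞)) Filter.atTop < (k : ℝ≥0∞))
    (h : ∀ n ≥ N, P n + m ≤ P (n + 1)) : m < k := by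
  by_contra! hkm
  obtain ⟨b, hb1, hb2⟩ := ENNReal.lt_iff_exists_nnreal_btwn.1 hP
  have hb2' : (b : ℝ) < k := by exact_mod_cast hb2
  obtain ⟨M, hM⟩ := Filter.eventually_atTop.1 (Filter.eventually_lt_of_limsup_lt hb1)
  have hlow : ∀ j, j * k ≤ P (N + j) := by
    intro j
    induction j with
    | zero => simp
    | succ j ih =>
      have := h (N + j) (by omega)
      rw [← add_assoc, add_mul, one_mul]
      omega
  -- Then `j * (k - b) > b * N`, which outweighs the start of the growth at `N` instead of 0.
  obtain ⟨j, hj⟩ := exists_nat_gt (b * N / (k - b) : ℝ)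
  have hjM := hM (N + (M + j + 1)) (by omega)
  rw [ENNReal.div_lt_iff (Or.inl (by simp)) (Or.inl (by simp))] at hjM
  have h1 : (P (N + (M + j + 1)) : ℝ) < b * (N + (M + j + 1) : ℕ) := by exact_mod_cast hjM
  have h2 : (((M + j + 1) * k : ℕ) : ℝ) ≤ P (N + (M + j + 1)) := by exact_mod_cast hlow (M + j + 1)
  rw [div_lt_iff₀ (by linarith)] at hj
  push_cast at h1 h2
  have : (0 : ℝ) ≤ (M + 1) * (k - b) := by
    have : (0 : ℝ) ≤ k - b := by linarith
    positivity
  nlinarith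

namespace TailSelection

variable (s : TailSelection X)

/-- The left halves of irregular points. -/
def irregularHalves : Set ({i : ℤ // i ≤ 0} → A) := leftHalf '' {x | s.Irregular x}

theorem encard_irregularHalves_lt [Finite A] {k : ℕ}
    (hk : Filter.limsup (fun n : ℕ => (complexity X n : ℝ≥0∞) / (n : ℝ≥0∞))
      Filter.atTop < (k : ℝ≥0∞)) : s.irregularHalves.encard < k := by
  by_contra! hcon
  obtain ⟨D, hD, hbij⟩ := (Set.surjOn_image leftHalf {x | s.Irregular x}).exists_bijOn_subset
  rw [irregularHalves, ← hbij.image_eq, hbij.injOn.encard_image] at hcon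
  -- The set of halves is not yet known to be finite, so exactly `k` of them are taken.
  obtain ⟨J, hJ, hJk⟩ := Set.exists_subset_encard_eq hcon
  have hJfin : J.Finite := Set.finite_of_encard_eq_coe hJk
  obtain ⟨N, hN⟩ := s.complexity_add_card_le hJfin.toFinset
    (fun x hx => hD (hJ (hJfin.mem_toFinset.1 hx)))
    (fun x hx y hy => hbij.injOn (hJ (hJfin.mem_toFinset.1 hx)) (hJ (hJfin.mem_toFinset.1 hy)))
  rw [hJfin.encard_eq_coe_toFinset_card] at hJk
  have hcard : hJfin.toFinset.card = k := by exact_mod_cast hJk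
  rw [hcard] at hN
  exact lt_irrefl _ (lt_of_limsup_div_lt hk hN)

end TailSelection

end Selection

theorem eq_add_mul_of_forall_lt {A : Type*} {x : ℤ → A} {t q : ℤ} (hq : 0 ≤ q)
    (h : ∀ i < t, x i = x (i + q)) (j : ℕ) : ∀ i, i + q * j < t + q → x i = x (i + q * j) := by
  induction j with
  | zero => simp
  | succ j ih =>
    intro i hi
    push_cast at hi ⊢
    rw [ih i (by nlinarith), h _ (by nlinarith)]
    exact congrArg _ (by ring)

/-! ### Orbits of asymptotic points and their translation amounts -/

section Selection

variable {A : Type*} [TopologicalSpace A] {X : Subshift A ℤ}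

theorem exists_periodic_of_left_periodic [DiscreteTopology A] [Finite A] {x : X.carrier} {t : ℤ}
    {q : ℕ} (hq : 0 < q) (h : ∀ i < t, x.1 i = x.1 (i + q)) :
    ∃ z : X.carrier, (shiftPerm X ^ q) z = z ∧ ∀ i < t, z.1 i = x.1 i := by
  have hcl : ∀ (Q : A → A → Prop) (i j : ℤ), IsClosed {z : X.carrier | Q (z.1 i) (z.1 j)} :=
    fun Q i j => (isClosed_coord Q i j).preimage (continuous_id.prodMk continuous_id)
  obtain ⟨z, hz⟩ := exists_forall_of_antitone
    (fun (n : ℕ) (z : X.carrier) => (∀ i < t + n, z.1 i = z.1 (i + q)) ∧ ∀ i < t, z.1 i = x.1 i)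
    (fun n z hz => ⟨fun i hi => hz.1 i (by push_cast; omega), hz.2⟩)
    (fun n => IsClosed.inter
      (isClosed_forall fun i => isClosed_forall fun _ => hcl (· = ·) i (i + q))
      (isClosed_forall fun i => isClosed_forall fun _ => hcl (fun a _ => a = x.1 i) i i))
    (fun n => by
      have hqn : (n : ℤ) ≤ q * n := by exact_mod_cast Nat.le_mul_of_pos_left n hq
      -- Moving `x` to the right by `q * n` keeps its symbols below `t` and extends the range of
      -- periodicity.
      refine ⟨(shiftPerm X ^ (-(q * n : ℤ))) x, fun i hi => ?_, fun i hi => ?_⟩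
      · rw [shiftPerm_zpow_apply, shiftPerm_zpow_apply, h _ (by linarith)]
        exact congrArg _ (by ring)
      · rw [shiftPerm_zpow_apply,
          eq_add_mul_of_forall_lt (Int.natCast_nonneg q) h n _ (by linarith)]
        exact congrArg _ (by ring))
  refine ⟨z, shiftPerm_pow_eq_self_iff.2 fun i => ?_, (hz 0).2⟩
  exact ((hz (i - t + 1).toNat).1 i (by omega)).symm

namespace TailSelection

variable (s : TailSelection X)

/-- The aperiodic points which are irregular at `0` and regular afterwards. -/
def lastIrregular : Set X.carrier :=
  {x | (∀ p : ℕ, 0 < p → (shiftPerm X ^ p) x ≠ x) ∧ s.Irregular x ∧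
    ∀ n : ℕ, 0 < n → ¬ s.Irregular ((shiftPerm X ^ n) x)}

/-- After 0 such points follow the selection, so the left half determines everything. -/
theorem injOn_leftHalf_lastIrregular : Set.InjOn leftHalf s.lastIrregular := by
  intro x hx y hy hxy
  rw [leftHalf_eq_iff] at hxy
  apply (shiftPerm X).injective
  refine s.ext_of_regular (fun i hi => ?_) (fun n => ?_) (fun n => ?_)
  · rw [shiftPerm_apply, shiftPerm_apply]
    exact hxy _ (by omega)
  · rw [← Equiv.Perm.mul_apply, ← pow_succ]
    exact hx.2.2 _ n.succ_pos
  · rw [← Equiv.Perm.mul_apply, ← pow_succ]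
    exact hy.2.2 _ n.succ_pos

theorem mapsTo_lastIrregular : Set.MapsTo leftHalf s.lastIrregular s.irregularHalves :=
  fun x hx => ⟨x, hx.2.1, rfl⟩

theorem exists_shift_mem_lastIrregular (hI : s.irregularHalves.Finite) {x : X.carrier}
    (hx : ∀ p : ℕ, 0 < p → (shiftPerm X ^ p) x ≠ x) {n : ℤ}
    (hn : s.Irregular ((shiftPerm X ^ n) x)) : ∃ m : ℤ, (shiftPerm X ^ m) x ∈ s.lastIrregular := by
  obtain ⟨m, hm, hmax⟩ :
      ∃ m : ℤ, s.Irregular ((shiftPerm X ^ m) x) ∧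
        ∀ z, s.Irregular ((shiftPerm X ^ z) x) → z ≤ m := by
    refine Int.exists_greatest_of_bdd ?_ ⟨n, hn⟩
    by_contra! hcon
    -- If irregularities occur arbitrarily far to the right, one of the finitely many halves recurs
    -- there. Two occurrences at distance `q` make that half `q`-periodic, and later ones spread the
    -- period to all of `x`.
    obtain ⟨v, -, hv⟩ : ∃ v ∈ s.irregularHalves,
        ∃ᶠ m : ℤ in Filter.atTop, leftHalf ((shiftPerm X ^ m) x) = v := by
      by_contra! hne
      obtain ⟨b, hb⟩ := Filter.eventually_atTop.1 ((Filter.eventually_all_finite hI).2 hne)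
      obtain ⟨z, hz, hbz⟩ := hcon b
      exact hb z hbz.le _ ⟨_, hz, rfl⟩ rfl
    rw [Filter.frequently_atTop] at hv
    have hv' : ∀ b : ℤ, ∃ m ≥ b, ∀ j (hj : j ≤ 0), x.1 (j + m) = v ⟨j, hj⟩ := by
      intro b
      obtain ⟨m, hm, rfl⟩ := hv b
      exact ⟨m, hm, fun j hj => (shiftPerm_zpow_apply m x j).symm⟩
    obtain ⟨m₁, -, h₁⟩ := hv' 0
    obtain ⟨m₂, hlt, h₂⟩ := hv' (m₁ + 1)
    obtain ⟨q, hq⟩ : ∃ q : ℕ, m₂ = m₁ + q := ⟨(m₂ - m₁).toNat, by omega⟩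
    refine hx q (by omega) (shiftPerm_pow_eq_self_iff.2 fun i => ?_)
    obtain ⟨m, hm, h⟩ := hv' (i + q)
    have e1 := h (i - m) (by omega)
    have e2 := h (i + q - m) (by omega)
    rw [← h₂, hq] at e1
    rw [← h₁] at e2
    rw [sub_add_cancel] at e1 e2
    rw [e1, e2]
    exact congrArg _ (by ring)
  refine ⟨m, fun p hp h => hx p hp ?_, hm, fun k hk h => ?_⟩
  · rw [← apply_pow_comm (f := shiftPerm X ^ m) ((Commute.refl _).zpow_left m)] at h
    exact Equiv.injective _ h
  · rw [← Equiv.Perm.mul_apply, ← zpow_natCast, ← zpow_add] at h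
    have := hmax _ h
    omega

/-- The points without irregularities from `0` on which share their left tail with an irregular
point. -/
def regularSiblings : Set X.carrier :=
  {x | (∀ n : ℕ, ¬ s.Irregular ((shiftPerm X ^ n) x)) ∧
    ∃ y : X.carrier, s.Irregular y ∧ ∀ i < 0, y.1 i = x.1 i}

theorem finite_regularSiblings (hI : s.irregularHalves.Finite) : s.regularSiblings.Finite := by
  have : ∀ x : s.regularSiblings, ∃ y : X.carrier, s.Irregular y ∧ ∀ i < 0, y.1 i = x.1.1 i :=
    fun x => x.2.2
  choose y hy hyx using this
  have := hI.to_subtype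
  have : Finite s.regularSiblings := by
    refine Finite.of_injective
      (fun x => (⟨leftHalf (y x), y x, hy x, rfl⟩ : s.irregularHalves)) fun x x' h => ?_
    have h' := leftHalf_eq_iff.1 (congrArg Subtype.val h)
    exact Subtype.ext (s.ext_of_regular
      (fun i hi => by rw [← hyx x i hi, ← hyx x' i hi, h' i hi.le]) x.2.1 x'.2.1)
  exact Set.toFinite _

theorem regularSiblings_subset : s.regularSiblings ⊆ asymptoticPoints X := by
  rintro x ⟨hx, y, hy, hyx⟩
  refine ⟨y, ?_, 0, hyx⟩
  rintro rfl
  exact hx 0 (by simpa using hy)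

theorem lastIrregular_subset : s.lastIrregular ⊆ asymptoticPoints X :=
  fun _ hx => s.mem_asymptoticPoints_of_irregular hx.2.1

theorem not_periodic_of_irregular {x : X.carrier} {n : ℤ}
    (hn : s.Irregular ((shiftPerm X ^ n) x)) (p : ℕ) (hp : 0 < p) : (shiftPerm X ^ p) x ≠ x :=
  fun h => s.not_irregular_of_periodic hp h n hn

/-- A point asymptotic to a different point shares, if it is never irregular, a left tail with a
point which is irregular afterwards. -/
theorem exists_irregular_of_mem_asymptoticPoints {x : X.carrier} (hx : x ∈ asymptoticPoints X)
    (hreg : ∀ n : ℤ, ¬ s.Irregular ((shiftPerm X ^ n) x)) :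
    ∃ y : X.carrier, ∃ t : ℤ, s.Irregular ((shiftPerm X ^ t) y) ∧ ∀ i < t, y.1 i = x.1 i := by
  obtain ⟨y, hne, t, ht⟩ := hx
  obtain ⟨t, ht, htne⟩ := exists_first_ne hne ht
  exact ⟨y, t, (s.irregular_or_of_ne ht htne).resolve_left (hreg t), ht⟩

/-- The base point of the orbit is the last irregularity, or, if there is none, the place where an
asymptotic partner branches off. -/
theorem exists_sameCycle (hI : s.irregularHalves.Finite) {x : X.carrier}
    (hx : x ∈ asymptoticPoints X) :
    ∃ b ∈ s.lastIrregular ∪ s.regularSiblings, (shiftPerm X).SameCycle x b := by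
  by_cases h : ∃ n : ℤ, s.Irregular ((shiftPerm X ^ n) x)
  · obtain ⟨n, hn⟩ := h
    obtain ⟨m, hm⟩ := s.exists_shift_mem_lastIrregular hI (s.not_periodic_of_irregular hn) hn
    exact ⟨_, Or.inl hm, m, rfl⟩
  · push Not at h
    obtain ⟨y, t, hy, hyx⟩ := s.exists_irregular_of_mem_asymptoticPoints hx h
    refine ⟨(shiftPerm X ^ t) x, Or.inr ⟨fun n => ?_, _, hy, shiftPerm_zpow_congr hyx⟩, t, rfl⟩
    rw [← zpow_natCast, ← Equiv.Perm.mul_apply, ← zpow_add]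
    exact h _

/-- The periodic point with the same left tail is never irregular, so `x` is irregular where the two
first differ. -/
theorem exists_irregular_of_left_periodic [DiscreteTopology A] [Finite A] {x : X.carrier}
    (hx : ∀ p : ℕ, 0 < p → (shiftPerm X ^ p) x ≠ x) {t : ℤ} {q : ℕ} (hq : 0 < q)
    (h : ∀ i < t, x.1 i = x.1 (i + q)) : ∃ n : ℤ, s.Irregular ((shiftPerm X ^ n) x) := by
  obtain ⟨z, hz, hzx⟩ := exists_periodic_of_left_periodic hq h
  have hne : z ≠ x := by
    rintro rfl
    exact hx q hq hz
  obtain ⟨n, hn, hnne⟩ := exists_first_ne hne hzx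
  exact ⟨n, (s.irregular_or_of_ne hn hnne).resolve_right (s.not_irregular_of_periodic hq hz n)⟩

/-- The translation amounts of automorphisms along the aperiodic orbits of asymptotic points are
determined by those along the orbits of `s.lastIrregular`. -/
theorem exists_translation_eq [DiscreteTopology A] [Finite A] (hI : s.irregularHalves.Finite)
    {x : X.carrier} (hx : x ∈ asymptoticPoints X)
    (hper : ∀ p : ℕ, 0 < p → (shiftPerm X ^ p) x ≠ x) :
    ∃ y ∈ s.lastIrregular, ∀ φ : X.carrier → X.carrier, Continuous φ →
      (∀ (n : ℤ) x, φ ((shiftPerm X ^ n) x) = (shiftPerm X ^ n) (φ x)) → ∀ m n : ℤ,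
      φ x = (shiftPerm X ^ m) x → φ y = (shiftPerm X ^ n) y → m = n := by
  have hshift : ∀ (y : X.carrier) (j n : ℤ) (φ : X.carrier → X.carrier),
      (∀ (n : ℤ) x, φ ((shiftPerm X ^ n) x) = (shiftPerm X ^ n) (φ x)) →
      φ ((shiftPerm X ^ j) y) = (shiftPerm X ^ n) ((shiftPerm X ^ j) y) →
      φ y = (shiftPerm X ^ n) y := by
    intro y j n φ hT h
    rw [hT, ← Equiv.Perm.mul_apply, ← zpow_add, add_comm, zpow_add, Equiv.Perm.mul_apply] at h
    exact Equiv.injective _ h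
  by_cases h : ∃ n : ℤ, s.Irregular ((shiftPerm X ^ n) x)
  · obtain ⟨n, hn⟩ := h
    obtain ⟨j, hj⟩ := s.exists_shift_mem_lastIrregular hI hper hn
    refine ⟨_, hj, fun φ _ hT m n hm hn => zpow_apply_injective hper ?_⟩
    rw [← hm, hshift x j n φ hT hn]
  · push Not at h
    obtain ⟨y, t, hy, hyx⟩ := s.exists_irregular_of_mem_asymptoticPoints hx h
    obtain ⟨j, hj⟩ := s.exists_shift_mem_lastIrregular hI (s.not_periodic_of_irregular hy) hy
    refine ⟨_, hj, fun φ hφ hT m n hm hn => ?_⟩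
    -- The images of `x` and `y` are again left-asymptotic. Different translations `m` and `n` would
    -- make `x` periodic far to the left, hence irregular somewhere.
    obtain ⟨u, hu⟩ := exists_forall_lt_apply_eq hφ hT hyx
    rw [hshift y j n φ hT hn, hm] at hu
    simp only [shiftPerm_zpow_apply] at hu
    have hmn : ∀ i, i < u → i < t - n → x.1 (i + m) = x.1 (i + n) := fun i h1 h2 => by
      rw [← hu i h1, hyx _ (by omega)]
    by_contra hne
    obtain ⟨q, hq⟩ : ∃ q : ℕ, n = m + q ∨ m = n + q := ⟨(n - m).natAbs, by omega⟩
    have hq0 : 0 < q := by omega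
    have hxq : ∀ i < min u (t - n) + min m n, x.1 i = x.1 (i + q) := by
      intro i hi
      rcases hq with rfl | rfl
      · have := hmn (i - m) (by omega) (by omega)
        rw [sub_add_cancel] at this
        exact this.trans (congrArg _ (by ring))
      · have := hmn (i - n) (by omega) (by omega)
        rw [sub_add_cancel] at this
        exact this.symm.trans (congrArg _ (by ring))
    obtain ⟨l, hl⟩ := s.exists_irregular_of_left_periodic hper hq0 hxq
    exact h l hl

end TailSelection

end Selection

/-! ### Automorphisms as permutations and the main theorem -/

section Main

variable {A : Type*} [TopologicalSpace A] {X : Subshift A ℤ}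

variable (X) in
/-- Automorphisms as permutations of the points of a subshift. -/
def autToPerm : Aut X →* Equiv.Perm X.carrier where
  toFun g := g.1.toEquiv
  map_one' := rfl
  map_mul' _ _ := rfl

theorem autToPerm_injective : Function.Injective (autToPerm X) := fun _ _ h =>
  Subtype.ext (Homeomorph.toEquiv_injective h)

theorem continuous_autToPerm (g : Aut X) : Continuous (autToPerm X g) := g.1.continuous

theorem commute_autToPerm (g : Aut X) : Commute (autToPerm X g) (shiftPerm X) := by
  have h : sigma X * g.1 = g.1 * sigma X := Subgroup.mem_centralizer_iff.1 g.2 _ rfl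
  exact (congrArg Homeomorph.toEquiv h).symm

theorem apply_mem_asymptoticPoints [DiscreteTopology A] [Finite A] {φ : Equiv.Perm X.carrier}
    (hφ : Continuous φ) (hT : Commute φ (shiftPerm X)) {x : X.carrier}
    (hx : x ∈ asymptoticPoints X) : φ x ∈ asymptoticPoints X := by
  obtain ⟨y, hne, t, ht⟩ := hx
  exact ⟨φ y, fun h => hne (φ.injective h), exists_forall_lt_apply_eq hφ (apply_zpow_comm hT) ht⟩

end Main

end LinearShift

theorem theorem1 {A : Type*} [Finite A] [TopologicalSpace A] [DiscreteTopology A]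
    (X : Subshift A ℤ) (k : ℕ)
    (hk : Filter.limsup (fun n : ℕ => (LinearShift.complexity X n : ℝ≥0∞) / (n : ℝ≥0∞))
      Filter.atTop < (k : ℝ≥0∞))
    (H : Subgroup (LinearShift.Aut X)) (hH : H.FG) :
    ∃ d : ℕ, d < k ∧ LinearShift.IsVirtually H (Multiplicative (Fin d → ℤ)) := by
  open LinearShift in
  obtain ⟨s⟩ := nonempty_tailSelection (X := X)
  have hIk := s.encard_irregularHalves_lt hk
  have hI : s.irregularHalves.Finite :=
    Set.encard_lt_top_iff.1 (hIk.trans (ENat.natCast_lt_top k))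
  have hS₀ : s.lastIrregular.Finite :=
    Set.Finite.of_injOn s.mapsTo_lastIrregular s.injOn_leftHalf_lastIrregular hI
  have hcard : s.lastIrregular.ncard < k := by
    refine (Set.ncard_le_ncard_of_injOn leftHalf s.mapsTo_lastIrregular
      s.injOn_leftHalf_lastIrregular hI).trans_lt ?_
    rw [← hI.cast_ncard_eq] at hIk
    exact_mod_cast hIk
  have : Group.FG H := (Group.fg_iff_subgroup_fg H).2 hH
  have hT : ∀ g : H, Commute (((autToPerm X).comp H.subtype) g) (shiftPerm X) :=
    fun g => commute_autToPerm g.1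
  obtain ⟨d, hd, hv⟩ := exists_isVirtually (ρ := (autToPerm X).comp H.subtype) (T := shiftPerm X)
    (S := asymptoticPoints X) (S₀ := s.lastIrregular) hT
    (autToPerm_injective.comp H.subtype_injective) (fun _ => finite_periodic)
    (fun g _ => apply_mem_asymptoticPoints (continuous_autToPerm g.1) (hT g))
    (hS₀.union (s.finite_regularSiblings hI))
    (Set.union_subset s.lastIrregular_subset s.regularSiblings_subset)
    (fun _ => s.exists_sameCycle hI)
    (fun g hg => exists_period_of_fixes (continuous_autToPerm g.1) (apply_zpow_comm (hT g)) hg)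
    hS₀ s.lastIrregular_subset (fun y hy => hy.1)
    (fun x hx hper => by
      obtain ⟨y, hy, h⟩ := s.exists_translation_eq hI hx hper
      exact ⟨y, hy, fun g => h _ (continuous_autToPerm g.1) (apply_zpow_comm (hT g))⟩)
  exact ⟨d, hd.trans_lt hcard, hv⟩
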